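/- Let $\mathbb K$ be an algebraically closed field. A symmetric Frobenius algebra $(A,\lambda^A)$ is an associative unital $\mathbb K$-algebra $A$ with a linear form $\lambda^A:A\to\mathbb K$ such that $\lambda^A(ab)=\lambda^A(ba)$ for all $a,b$ and the pairing $a\otimes b\mapsto\lambda^A(ab)$ is non-degenerate. If $A$ is semisimple and $X$ is a finitely generated left $A$-module, put $X^*=\operatorname{Hom}_A(X,A)$; the map $\Psi:X^*\otimes_A X\to\operatorname{End}_A(X)$, $f\otimes x\mapsto(y\mapsto f(y).x)$, is bijective, and the trace $\operatorname{tr}^{\lambda^A}_X:\operatorname{End}_A(X)\to\mathbb K$ is $\Psi^{-1}$ followed by $f\otimes x\mapsto\lambda^A(f(x))$. These traces form the Calabi–Yau structure on the category $(A\text{-Mod})^{fg}$ of finitely generated left $A$-modules. A Morita context $\mathcal M=(M,N,\varepsilon,\eta)$ between $\mathbb K$-algebras $A$ and $B$ consists of a $(B,A)$-bimodule $M$, an $(A,B)$-bimodule $N$ (with $\mathbb K$ acting in the same way from both sides), and isomorphisms of bimodules $\varepsilon:N\otimes_B M\to A$ and $\eta:B\to M\otimes_A N$ such that $m.\varepsilon(n\otimes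 m')=\eta^{-1}(m\otimes n).m'$ and $\varepsilon(n\otimes m).n'=n.\eta^{-1}(m\otimes n')$ for all $m,m'\in M$, $n,n'\in N$. It is compatible with Frobenius forms $\lambda^A,\lambda^B$ if, writing $\varepsilon^{-1}(1_A)=\sum_i n_i\otimes m_i$, one has $\lambda^A(a)=\sum_i\lambda^B\big(\eta^{-1}(m_i.a\otimes n_i)\big)$ for all $a\in A$. Write $\operatorname{Rep}^{fg}(\mathcal M)=M\otimes_A-:(A\text{-Mod})^{fg}\to(B\text{-Mod})^{fg}$. **Proposition.** Let $(A,\lambda^A)$ and $(B,\lambda^B)$ be semisimple symmetric Frobenius algebras over $\mathbb K$, and let $F:(A\text{-Mod})^{fg}\to(B\text{-Mod})^{fg}$ be an equivalence of Calabi–Yau categories, that is, a $\mathbb K$-linear equivalence of categories such that $\operatorname{tr}^{\lambda^A}_X(f)=\operatorname{tr}^{\lambda^B}_{F(X)}(F(f))$ for every finitely generated left $A$-module $X$ and every $f\in\operatorname{End}_A(X)$. Then there is a Morita context $\mathcal M$ between $A$ and $B$, compatible with $\lambda^A$ and $\lambda^B$, such that $\operatorname{Rep}^{fg}(\mathcal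 M)$ is naturally isomorphic to $F$. -/

import Mathlib

open CategoryTheory MulOpposite
open scoped TensorProduct

universe u v

noncomputable section

/-! ### Tensor products over a noncommutative ring

A right `A`-module is a module over `Aᵐᵒᵖ`; the element `m.a` is written `op a • m`. -/

/-- The relations `m.a ⊗ x = m ⊗ a.x`. -/
def balancedRel (A M X : Type*) [Ring A] [AddCommGroup M] [Module Aᵐᵒᵖ M]
    [AddCommGroup X] [Module A X] : Submodule ℤ (M ⊗[ℤ] X) :=
  Submodule.span ℤ {z | ∃ (m : M) (a : A) (x : X), z = (op a • m) ⊗ₜ[ℤ] x - m ⊗ₜ[ℤ] (a • x)}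

/-- The tensor product `M ⊗_A X` of a right `A`-module `M` and a left `A`-module `X`. -/
def BalTensor (A M X : Type*) [Ring A] [AddCommGroup M] [Module Aᵐᵒᵖ M]
    [AddCommGroup X] [Module A X] : Type _ :=
  (M ⊗[ℤ] X) ⧸ balancedRel A M X

namespace BalTensor

section Basic

variable {A M X : Type*} [Ring A] [AddCommGroup M] [Module Aᵐᵒᵖ M] [AddCommGroup X] [Module A X]

instance : AddCommGroup (BalTensor A M X) :=
  inferInstanceAs (AddCommGroup ((M ⊗[ℤ] X) ⧸ balancedRel A M X))

variable (A) in
/-- The pure tensor `m ⊗ x` in `M ⊗_A X`. -/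
def tmul (m : M) (x : X) : BalTensor A M X :=
  (balancedRel A M X).mkQ (m ⊗ₜ[ℤ] x)

theorem add_tmul (m m' : M) (x : X) : tmul A (m + m') x = tmul A m x + tmul A m' x := by
  simp only [tmul, TensorProduct.add_tmul]
  exact map_add _ _ _

theorem tmul_add (m : M) (x x' : X) : tmul A m (x + x') = tmul A m x + tmul A m x' := by
  simp only [tmul, TensorProduct.tmul_add]
  exact map_add _ _ _

theorem smul_tmul (m : M) (a : A) (x : X) : tmul A (op a • m) x = tmul A m (a • x) :=
  (Submodule.Quotient.eq _).2 (Submodule.subset_span ⟨m, a, x, rfl⟩)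

/-- `m ⊗ x` as a biadditive map. -/
def tmulHom : M →+ X →+ BalTensor A M X :=
  AddMonoidHom.mk' (fun m => AddMonoidHom.mk' (fun x => tmul A m x) (tmul_add m))
    (fun m m' => by ext x; exact add_tmul m m' x)

theorem tmul_zero (m : M) : tmul A m (0 : X) = 0 := map_zero (tmulHom (A := A) m)

theorem tmul_sum {ι : Type*} (s : Finset ι) (m : M) (x : ι → X) :
    tmul A m (∑ i ∈ s, x i) = ∑ i ∈ s, tmul A m (x i) :=
  map_sum (tmulHom (A := A) m) x s

theorem sum_tmul {ι : Type*} (s : Finset ι) (m : ι → M) (x : X) :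
    tmul A (∑ i ∈ s, m i) x = ∑ i ∈ s, tmul A (m i) x :=
  map_sum ((tmulHom (A := A) (M := M) (X := X)).flip x) m s

theorem induction_on {p : BalTensor A M X → Prop} (z : BalTensor A M X)
    (zero : p 0) (tmul : ∀ m x, p (tmul A m x)) (add : ∀ y z, p y → p z → p (y + z)) : p z := by
  obtain ⟨t, rfl⟩ := (balancedRel A M X).mkQ_surjective z
  induction t using TensorProduct.induction_on with
  | zero => rw [map_zero]; exact zero
  | tmul m x => exact tmul m x
  | add a b ha hb => rw [map_add]; exact add _ _ ha hb

/-- The universal property: balanced biadditive maps factor through `M ⊗_A X`. -/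
def lift {P : Type*} [AddCommGroup P] (φ : M →+ X →+ P)
    (hφ : ∀ (m : M) (a : A) (x : X), φ (op a • m) x = φ m (a • x)) : BalTensor A M X →+ P :=
  ((balancedRel A M X).liftQ
    (TensorProduct.liftAddHom (R := ℤ) φ (fun r m x => by simp)).toIntLinearMap (by
      refine Submodule.span_le.2 ?_
      rintro _ ⟨m, a, x, rfl⟩
      simp [hφ])).toAddMonoidHom

@[simp]
theorem lift_tmul {P : Type*} [AddCommGroup P] (φ : M →+ X →+ P)
    (hφ : ∀ (m : M) (a : A) (x : X), φ (op a • m) x = φ m (a • x)) (m : M) (x : X) :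
    lift φ hφ (tmul A m x) = φ m x := rfl

end Basic

section Map

variable {A M M' X X' : Type*} [Ring A] [AddCommGroup M] [Module Aᵐᵒᵖ M]
  [AddCommGroup M'] [Module Aᵐᵒᵖ M'] [AddCommGroup X] [Module A X] [AddCommGroup X'] [Module A X']

/-- The map `g ⊗ h : M ⊗_A X → M' ⊗_A X'`. -/
def map (g : M →ₗ[Aᵐᵒᵖ] M') (h : X →ₗ[A] X') : BalTensor A M X →+ BalTensor A M' X' :=
  lift (((tmulHom (A := A)).comp g.toAddMonoidHom).compl₂ h.toAddMonoidHom)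
    (fun m a x => by
      change tmul A (g (op a • m)) (h x) = tmul A (g m) (h (a • x))
      rw [map_smul, map_smul, smul_tmul])

@[simp]
theorem map_tmul (g : M →ₗ[Aᵐᵒᵖ] M') (h : X →ₗ[A] X') (m : M) (x : X) :
    map g h (tmul A m x) = tmul A (g m) (h x) := rfl

end Map

section Actions

variable {A M X : Type*} [Ring A] [AddCommGroup M] [Module Aᵐᵒᵖ M] [AddCommGroup X] [Module A X]

/-- The left action `b.(m ⊗ x) = (b.m) ⊗ x` on `M ⊗_A X` for a bimodule `M`. -/
instance leftModule {B : Type*} [Ring B] [Module B M] [SMulCommClass B Aᵐᵒᵖ M] :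
    Module B (BalTensor A M X) where
  smul b z := map (Module.toModuleEnd Aᵐᵒᵖ M b) LinearMap.id z
  one_smul z := by
    change map (Module.toModuleEnd Aᵐᵒᵖ M 1) LinearMap.id z = z
    induction z using induction_on with
    | zero => exact map_zero _
    | tmul m x => simp
    | add y z hy hz => rw [map_add, hy, hz]
  mul_smul b c z := by
    change map (Module.toModuleEnd Aᵐᵒᵖ M (b * c)) LinearMap.id z =
      map (Module.toModuleEnd Aᵐᵒᵖ M b) LinearMap.id
        (map (Module.toModuleEnd Aᵐᵒᵖ M c) LinearMap.id z)
    induction z using induction_on with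
    | zero => simp only [map_zero]
    | tmul m x => simp [mul_smul]
    | add y z hy hz => simp only [map_add, hy, hz]
  smul_zero b := map_zero _
  smul_add b := map_add _
  add_smul b c z := by
    change map (Module.toModuleEnd Aᵐᵒᵖ M (b + c)) LinearMap.id z =
      map (Module.toModuleEnd Aᵐᵒᵖ M b) LinearMap.id z +
        map (Module.toModuleEnd Aᵐᵒᵖ M c) LinearMap.id z
    induction z using induction_on with
    | zero => simp only [map_zero, add_zero]
    | tmul m x => simp only [map_tmul, map_add, LinearMap.add_apply, add_tmul]
    | add y z hy hz => rw [AddMonoidHom.map_add, hy, hz, AddMonoidHom.map_add, AddMonoidHom.map_add]; abel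
  zero_smul z := by
    change map (Module.toModuleEnd Aᵐᵒᵖ M 0) LinearMap.id z = 0
    induction z using induction_on with
    | zero => exact map_zero _
    | tmul m x =>
      rw [map_tmul, map_zero]
      exact map_zero ((tmulHom (A := A) (M := M) (X := X)).flip x)
    | add y z hy hz => rw [map_add, hy, hz, add_zero]

theorem left_smul_tmul {B : Type*} [Ring B] [Module B M] [SMulCommClass B Aᵐᵒᵖ M]
    (b : B) (m : M) (x : X) : b • tmul A m x = tmul A (b • m) x := rfl

/-- Right multiplication by an element of `C` on an `(A, C)`-bimodule, as an `A`-linear map. -/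
def rightMul {C : Type*} [Ring C] [Module Cᵐᵒᵖ X] [SMulCommClass A Cᵐᵒᵖ X] (c : Cᵐᵒᵖ) :
    X →ₗ[A] X where
  toFun x := c • x
  map_add' := smul_add c
  map_smul' a x := (smul_comm a c x).symm

/-- The right action `(m ⊗ x).c = m ⊗ (x.c)` on `M ⊗_A X` for a bimodule `X`. -/
instance rightModule {C : Type*} [Ring C] [Module Cᵐᵒᵖ X] [SMulCommClass A Cᵐᵒᵖ X] :
    Module Cᵐᵒᵖ (BalTensor A M X) where
  smul c z := map LinearMap.id (rightMul c) z
  one_smul z := by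
    change map LinearMap.id (rightMul 1) z = z
    induction z using induction_on with
    | zero => exact map_zero _
    | tmul m x => simp [rightMul]
    | add y z hy hz => rw [map_add, hy, hz]
  mul_smul b c z := by
    change map LinearMap.id (rightMul (b * c)) z =
      map LinearMap.id (rightMul b) (map LinearMap.id (rightMul c) z)
    induction z using induction_on with
    | zero => simp only [map_zero]
    | tmul m x => simp [rightMul, mul_smul]
    | add y z hy hz => simp only [map_add, hy, hz]
  smul_zero b := map_zero _
  smul_add b := map_add _
  add_smul b c z := by
    change map LinearMap.id (rightMul (b + c)) z =
      map LinearMap.id (rightMul b) z + map LinearMap.id (rightMul c) z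
    induction z using induction_on with
    | zero => simp only [map_zero, add_zero]
    | tmul m x => simp [rightMul, add_smul, tmul_add]
    | add y z hy hz => rw [AddMonoidHom.map_add, hy, hz, AddMonoidHom.map_add, AddMonoidHom.map_add]; abel
  zero_smul z := by
    change map LinearMap.id (rightMul 0) z = 0
    induction z using induction_on with
    | zero => exact map_zero _
    | tmul m x => simp [rightMul, tmul_zero]
    | add y z hy hz => rw [map_add, hy, hz, add_zero]

theorem right_smul_tmul {C : Type*} [Ring C] [Module Cᵐᵒᵖ X] [SMulCommClass A Cᵐᵒᵖ X]
    (c : C) (m : M) (x : X) : op c • tmul A m x = tmul A m (op c • x) := rfl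

/-- The `B`-linear map `id_M ⊗ f : M ⊗_A X → M ⊗_A Y`. -/
def lTensor {Y : Type*} [AddCommGroup Y] [Module A Y] (B : Type*) (M : Type*) [Ring B]
    [AddCommGroup M] [Module Aᵐᵒᵖ M] [Module B M] [SMulCommClass B Aᵐᵒᵖ M] (f : X →ₗ[A] Y) :
    BalTensor A M X →ₗ[B] BalTensor A M Y where
  toFun := map LinearMap.id f
  map_add' := map_add _
  map_smul' b z := by
    simp only [RingHom.id_apply]
    induction z using induction_on with
    | zero => simp only [smul_zero, map_zero]
    | tmul m x => rfl
    | add y z hy hz => simp only [smul_add, map_add, hy, hz]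

@[simp]
theorem lTensor_tmul {Y : Type*} [AddCommGroup Y] [Module A Y] (B : Type*) (M : Type*) [Ring B]
    [AddCommGroup M] [Module Aᵐᵒᵖ M] [Module B M] [SMulCommClass B Aᵐᵒᵖ M] (f : X →ₗ[A] Y)
    (m : M) (x : X) : lTensor B M f (tmul A m x) = tmul A m (f x) := rfl

end Actions

end BalTensor

/-! ### Symmetric Frobenius algebras -/

/-- A symmetric Frobenius form on a `K`-algebra `A`: a linear form `lam` with
`lam (a * b) = lam (b * a)` for which the pairing `a ⊗ b ↦ lam (a * b)` is nondegenerate. -/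
structure SymmFrobeniusForm (K : Type*) (A : Type*) [Field K] [Ring A] [Algebra K A] where
  /-- the Frobenius form -/
  form : A →ₗ[K] K
  nondegenerate : ((LinearMap.mul K A).compr₂ form).Nondegenerate
  symm : ∀ a b : A, form (a * b) = form (b * a)

/-! ### Morita contexts -/

/-- The left and right actions on `M` make it a `(B, A)`-bimodule over the field `K`: they
commute with each other and induce the same action of `K`. -/
class IsBimodule (K B A M : Type*) [Field K] [Ring B] [Algebra K B] [Ring A] [Algebra K A]
    [AddCommGroup M] [Module B M] [Module Aᵐᵒᵖ M] : Prop extends SMulCommClass B Aᵐᵒᵖ M where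
  central : ∀ (k : K) (m : M), algebraMap K B k • m = op (algebraMap K A k) • m

/-- An isomorphism of `(B, A)`-bimodules. -/
structure BimoduleIso (B A P Q : Type*) [Ring B] [Ring A]
    [AddCommGroup P] [Module B P] [Module Aᵐᵒᵖ P]
    [AddCommGroup Q] [Module B Q] [Module Aᵐᵒᵖ Q] extends P ≃ₗ[B] Q where
  map_right : ∀ (a : A) (p : P), toFun (op a • p) = op a • toFun p

/-- A Morita context `(M, N, ε, η)` between the `K`-algebras `A` and `B`. The two commuting
diagrams are written out on pure tensors, which determine them because `ε`, `η` are bijective. -/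
structure MoritaContext (K : Type v) (A B : Type u) [Field K] [Ring A] [Algebra K A]
    [Ring B] [Algebra K B] where
  /-- the `(B, A)`-bimodule -/
  M : Type u
  /-- the `(A, B)`-bimodule -/
  N : Type u
  [addCommGroupM : AddCommGroup M]
  [leftM : Module B M]
  [rightM : Module Aᵐᵒᵖ M]
  [bimoduleM : IsBimodule K B A M]
  [addCommGroupN : AddCommGroup N]
  [leftN : Module A N]
  [rightN : Module Bᵐᵒᵖ N]
  [bimoduleN : IsBimodule K A B N]
  /-- the isomorphism `N ⊗_B M → A` of `(A, A)`-bimodules -/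
  ε : BimoduleIso A A (BalTensor B N M) A
  /-- the isomorphism `B → M ⊗_A N` of `(B, B)`-bimodules -/
  η : BimoduleIso B B B (BalTensor A M N)
  /-- The composites `M ⊗_A N ⊗_B M ⟶ M` through `M ⊗_A A` (by `id ⊗ ε`) and
  through `B ⊗_B M` (by `η⁻¹ ⊗ id`) agree. -/
  triangle_M : ∀ (m : M) (n : N) (m' : M),
    op (ε.toLinearEquiv (BalTensor.tmul B n m')) • m =
      η.toLinearEquiv.symm (BalTensor.tmul A m n) • m'
  /-- The composites `N ⊗_B M ⊗_A N ⟶ N` through `A ⊗_A N` (by `ε ⊗ id`) and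
  through `N ⊗_B B` (by `id ⊗ η⁻¹`) agree. -/
  triangle_N : ∀ (n : N) (m : M) (n' : N),
    ε.toLinearEquiv (BalTensor.tmul B n m) • n' =
      op (η.toLinearEquiv.symm (BalTensor.tmul A m n')) • n

namespace MoritaContext

variable {K : Type v} {A B : Type u} [Field K] [Ring A] [Algebra K A] [Ring B] [Algebra K B]

attribute [instance] addCommGroupM leftM rightM bimoduleM addCommGroupN leftN rightN bimoduleN

/-- Compatibility of a Morita context with Frobenius forms: if `ε⁻¹(1) = ∑ i, n i ⊗ m i`, then
`lamA a = ∑ i, lamB (η⁻¹ (m i . a ⊗ n i))` for all `a`. -/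
def Compatible (C : MoritaContext K A B) (lamA : SymmFrobeniusForm K A)
    (lamB : SymmFrobeniusForm K B) : Prop :=
  ∀ (r : ℕ) (n : Fin r → C.N) (m : Fin r → C.M),
    C.ε.toLinearEquiv.symm 1 = ∑ i, BalTensor.tmul B (n i) (m i) →
    ∀ a : A, lamA.form a =
      ∑ i, lamB.form (C.η.toLinearEquiv.symm (BalTensor.tmul A (op a • m i) (n i)))

theorem exists_tmul_sum {A M X : Type*} [Ring A] [AddCommGroup M] [Module Aᵐᵒᵖ M]
    [AddCommGroup X] [Module A X] (z : BalTensor A M X) :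
    ∃ (r : ℕ) (m : Fin r → M) (x : Fin r → X), z = ∑ i, BalTensor.tmul A (m i) (x i) := by
  induction z using BalTensor.induction_on with
  | zero => exact ⟨0, Fin.elim0, Fin.elim0, by simp⟩
  | tmul m x => exact ⟨1, fun _ => m, fun _ => x, by simp⟩
  | add y z hy hz =>
    obtain ⟨r, m, x, rfl⟩ := hy
    obtain ⟨s, m', x', rfl⟩ := hz
    exact ⟨r + s, Fin.append m m', Fin.append x x', by simp [Fin.sum_univ_add]⟩

/-- The bimodule `M` of a Morita context is finitely generated over `B`. -/
instance finite_M (C : MoritaContext K A B) : Module.Finite B C.M := by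
  classical
  obtain ⟨r, n, m, h⟩ := exists_tmul_sum (C.ε.toLinearEquiv.symm 1)
  refine ⟨⟨Finset.univ.image m, ?_⟩⟩
  rw [eq_top_iff]
  rintro x -
  have h1 : (1 : A) = ∑ i, C.ε.toLinearEquiv (BalTensor.tmul B (n i) (m i)) := by
    rw [← map_sum, ← h, LinearEquiv.apply_symm_apply]
  have h2 : x = ∑ i, C.η.toLinearEquiv.symm (BalTensor.tmul A x (n i)) • m i := by
    conv_lhs => rw [← one_smul Aᵐᵒᵖ x, ← op_one, h1, Finset.op_sum, Finset.sum_smul]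
    exact Finset.sum_congr rfl fun i _ => C.triangle_M x (n i) (m i)
  rw [h2]
  exact Submodule.sum_mem _ fun i _ => Submodule.smul_mem _ _
    (Submodule.subset_span (by simp))

/-- `M ⊗_A X` is finitely generated over `B` if `M` is so and `X` is finitely generated. -/
theorem finite_balTensor (A B M X : Type*) [Ring A] [Ring B] [AddCommGroup M] [Module B M]
    [Module Aᵐᵒᵖ M] [SMulCommClass B Aᵐᵒᵖ M] [AddCommGroup X] [Module A X]
    [Module.Finite B M] [Module.Finite A X] : Module.Finite B (BalTensor A M X) := by
  classical
  obtain ⟨s, hs⟩ := Module.Finite.fg_top (R := B) (M := M)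
  obtain ⟨t, ht⟩ := Module.Finite.fg_top (R := A) (M := X)
  refine ⟨⟨(s ×ˢ t).image (fun p => BalTensor.tmul A p.1 p.2), ?_⟩⟩
  set W := Submodule.span B
    (((s ×ˢ t).image (fun p => BalTensor.tmul A p.1 p.2) : Finset _) : Set (BalTensor A M X))
    with hW
  have h1 : ∀ (m : M), ∀ x ∈ t, BalTensor.tmul A m x ∈ W := by
    intro m x hx
    have hm : m ∈ Submodule.span B (s : Set M) := hs ▸ Submodule.mem_top
    induction hm using Submodule.span_induction with
    | mem m hm =>
      refine Submodule.subset_span ?_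
      simp only [Finset.coe_image, Set.mem_image, Finset.mem_coe, Finset.mem_product]
      exact ⟨(m, x), ⟨hm, hx⟩, rfl⟩
    | zero =>
      have : BalTensor.tmul A (0 : M) x = 0 :=
        map_zero ((BalTensor.tmulHom (A := A) (M := M) (X := X)).flip x)
      rw [this]; exact W.zero_mem
    | add p q _ _ hp hq => rw [BalTensor.add_tmul]; exact W.add_mem hp hq
    | smul b p _ hp => rw [← BalTensor.left_smul_tmul]; exact W.smul_mem b hp
  have h2 : ∀ (x : X) (m : M), BalTensor.tmul A m x ∈ W := by
    intro x
    have hx : x ∈ Submodule.span A (t : Set X) := ht ▸ Submodule.mem_top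
    induction hx using Submodule.span_induction with
    | mem x hx => exact fun m => h1 m x hx
    | zero => intro m; rw [BalTensor.tmul_zero]; exact W.zero_mem
    | add p q _ _ hp hq => intro m; rw [BalTensor.tmul_add]; exact W.add_mem (hp m) (hq m)
    | smul a p _ hp => intro m; rw [← BalTensor.smul_tmul]; exact hp _
  rw [eq_top_iff]
  rintro z -
  induction z using BalTensor.induction_on with
  | zero => exact W.zero_mem
  | tmul m x => exact h2 x m
  | add y z hy hz => exact W.add_mem hy hz

instance (C : MoritaContext K A B) (X : Type*) [AddCommGroup X] [Module A X]
    [Module.Finite A X] : Module.Finite B (BalTensor A C.M X) :=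
  finite_balTensor A B C.M X

/-- The functor `M ⊗_A -` from finitely generated left `A`-modules to finitely generated left
`B`-modules given by a Morita context. -/
def repFG (C : MoritaContext K A B) : FGModuleCat.{u} A ⥤ FGModuleCat.{u} B where
  obj X := FGModuleCat.of B (BalTensor A C.M X)
  map f := FGModuleCat.ofHom (BalTensor.lTensor B C.M f.hom.hom)
  map_id X := by
    refine FGModuleCat.hom_ext (LinearMap.ext fun z => ?_)
    induction z using BalTensor.induction_on with
    | zero => simp only [map_zero]
    | tmul m x => rfl
    | add y z hy hz => rw [map_add, map_add, hy, hz]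
  map_comp f g := by
    refine FGModuleCat.hom_ext (LinearMap.ext fun z => ?_)
    induction z using BalTensor.induction_on with
    | zero => simp only [map_zero]
    | tmul m x => rfl
    | add y z hy hz => rw [map_add, map_add, hy, hz]

end MoritaContext

/-! ### Calabi-Yau structures -/

/-- A Calabi-Yau structure (a trace) on a `K`-linear category. -/
structure CalabiYauStructure (K : Type*) [Field K] (C : Type*) [Category* C] [Preadditive C]
    [Linear K C] where
  /-- the trace on the endomorphisms of `c` -/
  tr : ∀ c : C, (c ⟶ c) →ₗ[K] K
  cyclic : ∀ {c d : C} (f : c ⟶ d) (g : d ⟶ c), tr c (f ≫ g) = tr d (g ≫ f)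
  nondegenerate_left : ∀ {c d : C} (f : c ⟶ d), (∀ g : d ⟶ c, tr c (f ≫ g) = 0) → f = 0
  nondegenerate_right : ∀ {c d : C} (g : d ⟶ c), (∀ f : c ⟶ d, tr c (f ≫ g) = 0) → g = 0

/-- A functor between categories with Calabi-Yau structures that preserves the traces. -/
def IsCalabiYauFunctor {K : Type*} [Field K] {C D : Type*} [Category* C] [Preadditive C]
    [Linear K C] [Category* D] [Preadditive D] [Linear K D] (trC : CalabiYauStructure K C)
    (trD : CalabiYauStructure K D) (F : C ⥤ D) : Prop :=
  ∀ (c : C) (f : c ⟶ c), trC.tr c f = trD.tr (F.obj c) (F.map f)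

/-! ### The trace on finitely generated modules over a semisimple symmetric Frobenius algebra -/

section Trace

variable (A : Type*) [Ring A] (P Q : Type*) [AddCommGroup P] [Module A P]
  [AddCommGroup Q] [Module A Q]

/-- The map `Ψ : P* ⊗_A Q → Hom_A(P, Q)`, `f ⊗ q ↦ (x ↦ f(x).q)`, where `P* = Hom_A(P, A)` is a
right `A`-module by `(f.a)(x) = f(x) a`. -/
def dualTensorHomA : BalTensor A (P →ₗ[A] A) Q →+ (P →ₗ[A] Q) :=
  BalTensor.lift
    (AddMonoidHom.mk' (fun f => AddMonoidHom.mk' (fun q => f.smulRight q)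
      (fun q q' => by ext x; simp)) (fun f f' => by ext q x; simp [add_smul]))
    (fun f a q => by ext x; simp [mul_smul])

@[simp]
theorem dualTensorHomA_tmul (f : P →ₗ[A] A) (q : Q) (x : P) :
    dualTensorHomA A P Q (BalTensor.tmul A f q) x = f x • q := rfl

theorem exists_dualBasis [Module.Finite A P] [Module.Projective A P] :
    ∃ (r : ℕ) (f : Fin r → (P →ₗ[A] A)) (p : Fin r → P), ∀ x, x = ∑ i, f i x • p i := by
  obtain ⟨r, s, t, -, -, h⟩ := Module.Finite.exists_comp_eq_id_of_projective A P
  refine ⟨r, fun i => (LinearMap.proj i).comp t, fun i => s (Pi.single i 1), fun x => ?_⟩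
  have hx : s (t x) = x := LinearMap.congr_fun h x
  conv_lhs => rw [← hx, pi_eq_sum_univ' (t x)]
  simp [map_sum]

variable {A P} in
theorem sum_tmul_dualTensorHomA {r : ℕ} {f : Fin r → (P →ₗ[A] A)} {p : Fin r → P}
    (h : ∀ x, x = ∑ i, f i x • p i) (z : BalTensor A (P →ₗ[A] A) Q) :
    ∑ i, BalTensor.tmul A (f i) (dualTensorHomA A P Q z (p i)) = z := by
  induction z using BalTensor.induction_on with
  | zero => simp [BalTensor.tmul_zero]
  | tmul g q =>
    simp only [dualTensorHomA_tmul, ← BalTensor.smul_tmul, ← BalTensor.sum_tmul]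
    congr 1
    ext x
    conv_rhs => rw [h x]
    simp
  | add y z hy hz =>
    simp only [map_add, LinearMap.add_apply, BalTensor.tmul_add, Finset.sum_add_distrib, hy, hz]

variable {A P} in
theorem dualTensorHomA_sum {r : ℕ} {f : Fin r → (P →ₗ[A] A)} {p : Fin r → P}
    (h : ∀ x, x = ∑ i, f i x • p i) (g : P →ₗ[A] Q) :
    dualTensorHomA A P Q (∑ i, BalTensor.tmul A (f i) (g (p i))) = g := by
  ext x
  conv_rhs => rw [h x]
  simp [map_sum, LinearMap.sum_apply]

/-- For `P` finitely generated projective, `Ψ` is an isomorphism. -/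
def dualTensorEquivA [Module.Finite A P] [Module.Projective A P] :
    BalTensor A (P →ₗ[A] A) Q ≃+ (P →ₗ[A] Q) :=
  AddEquiv.ofBijective (dualTensorHomA A P Q) (by
    obtain ⟨r, f, p, h⟩ := exists_dualBasis A P
    refine ⟨fun y z hyz => ?_, fun g => ⟨_, dualTensorHomA_sum Q h g⟩⟩
    rw [← sum_tmul_dualTensorHomA Q h y, ← sum_tmul_dualTensorHomA Q h z, hyz])

variable {A}
variable {K : Type*} [Field K] [Algebra K A] (lam : SymmFrobeniusForm K A)

/-- The composite of the evaluation `P* ⊗_A P → A`, `f ⊗ p ↦ f(p)`, and the Frobenius form.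
(The evaluation is well defined only modulo commutators; the composite is well defined as the
Frobenius form is symmetric.) -/
def frobeniusEval : BalTensor A (P →ₗ[A] A) P →+ K :=
  BalTensor.lift
    (AddMonoidHom.mk' (fun f => AddMonoidHom.mk' (fun p => lam.form (f p))
      (fun q q' => by simp)) (fun f f' => by ext q; simp))
    (fun f a q => by
      change lam.form (f q * a) = lam.form (f (a • q))
      rw [map_smul, smul_eq_mul, lam.symm])

@[simp]
theorem frobeniusEval_tmul (f : P →ₗ[A] A) (p : P) :
    frobeniusEval P lam (BalTensor.tmul A f p) = lam.form (f p) := rfl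

/-- The trace `End_A(P) → P* ⊗_A P → A → K`, the composite of `Ψ⁻¹`, evaluation and the
Frobenius form. -/
def frobeniusTrace [Module.Finite A P] [Module.Projective A P] : (P →ₗ[A] P) →+ K :=
  (frobeniusEval P lam).comp (dualTensorEquivA A P P).symm.toAddMonoidHom

variable {P} in
theorem frobeniusTrace_eq [Module.Finite A P] [Module.Projective A P] {r : ℕ}
    {f : Fin r → (P →ₗ[A] A)} {p : Fin r → P} (h : ∀ x, x = ∑ i, f i x • p i) (g : P →ₗ[A] P) :
    frobeniusTrace P lam g = ∑ i, lam.form (f i (g (p i))) := by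
  have : (dualTensorEquivA A P P).symm g = ∑ i, BalTensor.tmul A (f i) (g (p i)) := by
    rw [AddEquiv.symm_apply_eq]
    exact (dualTensorHomA_sum P h g).symm
  change frobeniusEval P lam ((dualTensorEquivA A P P).symm g) = _
  simp [this, map_sum]

variable {P} in
theorem frobeniusTrace_smulRight [Module.Finite A P] [Module.Projective A P]
    (f : P →ₗ[A] A) (p : P) : frobeniusTrace P lam (f.smulRight p) = lam.form (f p) := by
  have : (dualTensorEquivA A P P).symm (f.smulRight p) = BalTensor.tmul A f p := by
    rw [AddEquiv.symm_apply_eq]; rfl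
  change frobeniusEval P lam ((dualTensorEquivA A P P).symm (f.smulRight p)) = _
  simp [this]

variable {P Q} in
theorem frobeniusTrace_comm [Module.Finite A P] [Module.Projective A P] [Module.Finite A Q]
    [Module.Projective A Q] (f : P →ₗ[A] Q) (g : Q →ₗ[A] P) :
    frobeniusTrace P lam (g ∘ₗ f) = frobeniusTrace Q lam (f ∘ₗ g) := by
  obtain ⟨r, φ, p, hp⟩ := exists_dualBasis A P
  have h1 : g ∘ₗ f = ∑ i, (φ i ∘ₗ g ∘ₗ f).smulRight (p i) := by
    ext x
    conv_lhs => rw [hp ((g ∘ₗ f) x)]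
    simp
  have h2 : f ∘ₗ g = ∑ i, (φ i ∘ₗ g).smulRight (f (p i)) := by
    ext x
    conv_lhs => rw [LinearMap.comp_apply, hp (g x)]
    simp
  rw [h1, h2, map_sum, map_sum]
  simp [frobeniusTrace_smulRight]

end Trace

section FGModules

variable {K : Type v} {A : Type u} [Field K] [Ring A] [Algebra K A] [IsSemisimpleRing A]

theorem projective_fgModuleCat (X : FGModuleCat.{u} A) : Module.Projective A X :=
  Module.projective_of_isSemisimpleRing A X

attribute [local instance] projective_fgModuleCat

/-- The Calabi-Yau structure on the category of finitely generated modules over a semisimple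
symmetric Frobenius algebra. -/
def SymmFrobeniusForm.calabiYau (lam : SymmFrobeniusForm K A) :
    CalabiYauStructure K (FGModuleCat.{u} A) where
  tr X :=
    { toFun := fun f => frobeniusTrace X lam f.hom.hom
      map_add' := fun f g => map_add (frobeniusTrace X lam) f.hom.hom g.hom.hom
      map_smul' := fun k f => by
        obtain ⟨r, φ, p, hp⟩ := exists_dualBasis A X
        rw [frobeniusTrace_eq lam hp, frobeniusTrace_eq lam hp, RingHom.id_apply, smul_eq_mul,
          Finset.mul_sum]
        refine Finset.sum_congr rfl fun i _ => ?_
        have : (k • f).hom.hom (p i) = algebraMap K A k • f.hom.hom (p i) := rfl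
        rw [this, map_smul, smul_eq_mul, ← Algebra.smul_def, map_smul, smul_eq_mul] }
  cyclic f g := frobeniusTrace_comm lam f.hom.hom g.hom.hom
  nondegenerate_left {X Y} f hf := by
    have key : ∀ (ψ : Y →ₗ[A] A) (x : X), lam.form (ψ (f.hom.hom x)) = 0 := by
      intro ψ x
      have h := hf (FGModuleCat.ofHom (ψ.smulRight x))
      have h' : frobeniusTrace X lam ((ψ ∘ₗ f.hom.hom).smulRight x) = 0 := h
      rwa [frobeniusTrace_smulRight] at h'
    have key2 : ∀ (ψ : Y →ₗ[A] A) (x : X), ψ (f.hom.hom x) = 0 := fun ψ x =>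
      lam.nondegenerate.1 _ fun b => key (op b • ψ) x
    obtain ⟨r, φ, p, hp⟩ := exists_dualBasis A Y
    refine FGModuleCat.hom_ext (LinearMap.ext fun x => ?_)
    rw [hp (f.hom.hom x)]
    exact Finset.sum_eq_zero fun i _ => by rw [key2, zero_smul]
  nondegenerate_right {X Y} g hg := by
    have key : ∀ (ψ : X →ₗ[A] A) (y : Y), lam.form (ψ (g.hom.hom y)) = 0 := by
      intro ψ y
      have h := hg (FGModuleCat.ofHom (ψ.smulRight y))
      have h' : frobeniusTrace X lam (g.hom.hom ∘ₗ ψ.smulRight y) = 0 := h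
      have h2 : g.hom.hom ∘ₗ ψ.smulRight y = ψ.smulRight (g.hom.hom y) := by
        ext x; simp
      rwa [h2, frobeniusTrace_smulRight] at h'
    have key2 : ∀ (ψ : X →ₗ[A] A) (y : Y), ψ (g.hom.hom y) = 0 := fun ψ y =>
      lam.nondegenerate.1 _ fun b => key (op b • ψ) y
    obtain ⟨r, φ, p, hp⟩ := exists_dualBasis A X
    refine FGModuleCat.hom_ext (LinearMap.ext fun y => ?_)
    rw [hp (g.hom.hom y)]
    exact Finset.sum_eq_zero fun i _ => by rw [key2, zero_smul]

end FGModules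

end

/-! By functoriality the `B`-module `F(A)` carries a right action of `A`, and since a finitely
generated `A`-module `X` is projective, a dual basis of `X` shows `F(A) ⊗_A X ≃ F(X)`. As `F` is an
equivalence, `F(A)` is a progenerator over `B` on which right multiplication identifies `A` with
the endomorphism ring, so `F(A)` and its `B`-dual form a Morita context. In this context `ε⁻¹(1)`
is a dual basis of `F(A)`; compatibility with the Frobenius forms therefore says that right
multiplication by `a` on `F(A)` has trace `λ^A(a)`. This right multiplication is the image under
`F` of right multiplication by `a` on `A`, whose trace is `λ^A(a)`. -/

noncomputable section

namespace BalTensor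

variable {A M X P : Type*} [Ring A] [AddCommGroup M] [Module Aᵐᵒᵖ M] [AddCommGroup X] [Module A X]
  [AddCommGroup P]

theorem zero_tmul (x : X) : tmul A (0 : M) x = 0 :=
  map_zero ((tmulHom (A := A) (M := M) (X := X)).flip x)

theorem map_left_smul_of_tmul {B : Type*} [Ring B] [Module B M] [SMulCommClass B Aᵐᵒᵖ M]
    [Module B P] {f : BalTensor A M X →+ P}
    (hf : ∀ (b : B) m x, f (tmul A (b • m) x) = b • f (tmul A m x))
    (b : B) (z : BalTensor A M X) : f (b • z) = b • f z := by
  induction z using induction_on with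
  | zero => simp only [smul_zero, map_zero]
  | tmul m x => exact hf b m x
  | add y z hy hz => simp only [smul_add, map_add, hy, hz]

theorem map_right_smul_of_tmul {C : Type*} [Ring C] [Module Cᵐᵒᵖ X] [SMulCommClass A Cᵐᵒᵖ X]
    [Module Cᵐᵒᵖ P] {f : BalTensor A M X →+ P}
    (hf : ∀ (c : Cᵐᵒᵖ) m x, f (tmul A m (c • x)) = c • f (tmul A m x))
    (c : Cᵐᵒᵖ) (z : BalTensor A M X) : f (c • z) = c • f z := by
  induction z using induction_on with
  | zero => simp only [smul_zero, map_zero]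
  | tmul m x => exact hf c m x
  | add y z hy hz => simp only [smul_add, map_add, hy, hz]

end BalTensor

namespace BimoduleIso

variable {B A P Q R : Type*} [Ring B] [Ring A] [AddCommGroup P] [Module B P] [Module Aᵐᵒᵖ P]
  [AddCommGroup Q] [Module B Q] [Module Aᵐᵒᵖ Q] [AddCommGroup R] [Module B R] [Module Aᵐᵒᵖ R]

/-- A bijective homomorphism of bimodules is an isomorphism of bimodules. -/
def ofBijective (f : P →ₗ[B] Q) (hf : Function.Bijective f)
    (hr : ∀ (a : A) (p : P), f (op a • p) = op a • f p) : BimoduleIso B A P Q where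
  toLinearEquiv := LinearEquiv.ofBijective f hf
  map_right := hr

/-- The inverse of an isomorphism of bimodules. -/
def symm (e : BimoduleIso B A P Q) : BimoduleIso B A Q P where
  toLinearEquiv := e.toLinearEquiv.symm
  map_right a q := e.toLinearEquiv.injective <| by
    refine (e.toLinearEquiv.apply_symm_apply _).trans (.trans ?_ (e.map_right a _).symm)
    exact congrArg (op a • ·) (e.toLinearEquiv.apply_symm_apply q).symm

/-- The composite of two isomorphisms of bimodules. -/
def trans (e : BimoduleIso B A P Q) (e' : BimoduleIso B A Q R) : BimoduleIso B A P R where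
  toLinearEquiv := e.toLinearEquiv.trans e'.toLinearEquiv
  map_right a p := (congrArg e'.toFun (e.map_right a p)).trans (e'.map_right a _)

end BimoduleIso

section Bimodule

variable {A B M P : Type*} [Ring A] [Ring B] [AddCommGroup M] [Module B M] [Module Aᵐᵒᵖ M]
  [SMulCommClass B Aᵐᵒᵖ M] [AddCommGroup P] [Module B P]

/-- For a `(B, A)`-bimodule `M`, the left `A`-module structure `(a.f)(m) = f(m.a)` on
`Hom_B(M, P)`. For `P = B` it makes the dual of `M` an `(A, B)`-bimodule. -/
@[reducible]
def homLeftModule : Module A (M →ₗ[B] P) where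
  smul a f := f ∘ₗ BalTensor.rightMul (op a)
  one_smul f := LinearMap.ext fun m => congrArg f (one_smul Aᵐᵒᵖ m)
  mul_smul a b f := LinearMap.ext fun m => congrArg f (mul_smul (op b) (op a) m)
  smul_zero _ := rfl
  smul_add _ _ _ := rfl
  add_smul a b f := LinearMap.ext fun m =>
    (congrArg f (add_smul (op a) (op b) m)).trans (map_add f _ _)
  zero_smul f := LinearMap.ext fun m => (congrArg f (zero_smul Aᵐᵒᵖ m)).trans (map_zero f)

attribute [local instance] homLeftModule

theorem homLeftModule_smul_apply (a : A) (f : M →ₗ[B] P) (m : M) : (a • f) m = f (op a • m) := rfl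

instance homLeftModule_smulCommClass {C : Type*} [Ring C] [Module Cᵐᵒᵖ P]
    [SMulCommClass B Cᵐᵒᵖ P] : SMulCommClass A Cᵐᵒᵖ (M →ₗ[B] P) where
  smul_comm _ _ _ := rfl

variable (A B M) in
/-- Right multiplication `A → End_B(M)` on a `(B, A)`-bimodule `M`. -/
def rightMulHom : A →ₗ[A] (M →ₗ[B] M) where
  toFun a := BalTensor.rightMul (op a)
  map_add' a b := LinearMap.ext fun m => add_smul (op a) (op b) m
  map_smul' a b := LinearMap.ext fun m => mul_smul (op b) (op a) m

variable (B M) in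
/-- The `B`-module `M` is a generator: its trace ideal, spanned by the values of the linear forms
on `M`, is all of `B`. -/
def IsGenerator : Prop :=
  ∃ (r : ℕ) (f : Fin r → (M →ₗ[B] B)) (m : Fin r → M), ∑ i, f i (m i) = 1

variable (A B M) in
/-- The evaluation `M ⊗_A Hom_B(M, B) → B`, `m ⊗ f ↦ f(m)`. -/
def evaluation : BalTensor A M (M →ₗ[B] B) →ₗ[B] B where
  __ := BalTensor.lift (AddMonoidHom.mk' (fun m => AddMonoidHom.mk' (fun f : M →ₗ[B] B => f m)
    fun _ _ => rfl) fun m m' => by ext f; exact map_add f m m') fun _ _ _ => rfl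
  map_smul' := BalTensor.map_left_smul_of_tmul fun b m f => map_smul f b m

@[simp]
theorem evaluation_tmul (m : M) (f : M →ₗ[B] B) : evaluation A B M (BalTensor.tmul A m f) = f m :=
  rfl

theorem sum_evaluation_smul_tmul (hA : Function.Surjective (rightMulHom A B M)) {r : ℕ}
    {f : Fin r → (M →ₗ[B] B)} {m : Fin r → M} (h : ∑ i, f i (m i) = 1)
    (z : BalTensor A M (M →ₗ[B] B)) :
    ∑ i, BalTensor.tmul A (evaluation A B M z • m i) (f i) = z := by
  induction z using BalTensor.induction_on with
  | zero => simp only [map_zero, zero_smul, BalTensor.zero_tmul, Finset.sum_const_zero]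
  | tmul x g =>
    -- The endomorphism `y ↦ g(y).m i` is right multiplication by some `a`, which moves across `⊗`.
    have move (i : Fin r) :
        BalTensor.tmul A (g x • m i) (f i) = BalTensor.tmul A x (op (f i (m i)) • g) := by
      obtain ⟨a, ha⟩ := hA (g.smulRight (m i))
      have ha (y : M) : op a • y = g y • m i := LinearMap.congr_fun ha y
      rw [← ha, BalTensor.smul_tmul]
      congr 1
      ext y
      rw [homLeftModule_smul_apply, ha, map_smul, LinearMap.smul_apply, op_smul_eq_mul, smul_eq_mul]
    simp only [evaluation_tmul, move, ← BalTensor.tmul_sum, ← Finset.sum_smul, ← Finset.op_sum, h,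
      op_one, one_smul]
  | add y z hy hz =>
    simp only [map_add, add_smul, BalTensor.add_tmul, Finset.sum_add_distrib, hy, hz]

theorem evaluation_bijective (hA : Function.Surjective (rightMulHom A B M))
    (hM : IsGenerator B M) : Function.Bijective (evaluation A B M) := by
  obtain ⟨r, f, m, h⟩ := hM
  refine ⟨(injective_iff_map_eq_zero _).2 fun z hz => ?_, fun b => ?_⟩
  · rw [← sum_evaluation_smul_tmul hA h z]
    simp only [hz, zero_smul, BalTensor.zero_tmul, Finset.sum_const_zero]
  · refine ⟨b • ∑ i, BalTensor.tmul A (m i) (f i), ?_⟩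
    simp only [map_smul, map_sum, evaluation_tmul, h, smul_eq_mul, mul_one]

/-- The evaluation as an isomorphism `M ⊗_A Hom_B(M, B) → B` of `(B, B)`-bimodules. -/
def evaluationIso (hA : Function.Surjective (rightMulHom A B M)) (hM : IsGenerator B M) :
    BimoduleIso B B (BalTensor A M (M →ₗ[B] B)) B :=
  .ofBijective (evaluation A B M) (evaluation_bijective hA hM) fun b =>
    BalTensor.map_right_smul_of_tmul (f := (evaluation A B M).toAddMonoidHom)
      (fun _ _ _ => rfl) (op b)

/-- Right multiplication as an isomorphism `A → End_B(M)` of `(A, A)`-bimodules. -/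
def rightMulIso (hA : Function.Bijective (rightMulHom A B M)) :
    BimoduleIso A A A (M →ₗ[B] M) :=
  .ofBijective (rightMulHom A B M) hA fun a b => LinearMap.ext fun m => mul_smul (op a) (op b) m

variable [Module.Finite B M] [Module.Projective B M]

variable (A B M) in
/-- The map `Ψ : Hom_B(M, B) ⊗_B M → End_B(M)` as an isomorphism of `(A, A)`-bimodules. -/
def dualTensorIso : BimoduleIso A A (BalTensor B (M →ₗ[B] B) M) (M →ₗ[B] M) :=
  .ofBijective
    { dualTensorHomA B M M with
      map_smul' := BalTensor.map_left_smul_of_tmul fun _ _ _ => rfl }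
    (dualTensorEquivA B M M).bijective
    fun a => BalTensor.map_right_smul_of_tmul (f := dualTensorHomA B M M)
      (fun a f m => LinearMap.ext fun x => by
        rw [dualTensorHomA_tmul, LinearMap.smul_apply, dualTensorHomA_tmul, smul_comm]) (op a)

/-- The composite `Hom_B(M, B) ⊗_B M ≃ End_B(M) ≃ A`. -/
def dualTensorRingIso (hA : Function.Bijective (rightMulHom A B M)) :
    BimoduleIso A A (BalTensor B (M →ₗ[B] B) M) A :=
  (dualTensorIso A B M).trans (rightMulIso hA).symm

theorem op_dualTensorRingIso_smul (hA : Function.Bijective (rightMulHom A B M))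
    (z : BalTensor B (M →ₗ[B] B) M) (x : M) :
    op ((dualTensorRingIso hA).toLinearEquiv z) • x = dualTensorHomA B M M z x :=
  LinearMap.congr_fun ((rightMulIso hA).toLinearEquiv.apply_symm_apply _) x

end Bimodule

attribute [local instance] homLeftModule in
theorem IsBimodule.dual (K : Type*) {A B M : Type*} [Field K] [Ring A] [Algebra K A] [Ring B]
    [Algebra K B] [AddCommGroup M] [Module B M] [Module Aᵐᵒᵖ M] [IsBimodule K B A M] :
    IsBimodule K A B (M →ₗ[B] B) where
  central k f := LinearMap.ext fun m => by
    rw [homLeftModule_smul_apply, ← IsBimodule.central (B := B), map_smul, LinearMap.smul_apply,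
      op_smul_eq_mul, smul_eq_mul, Algebra.commutes]

namespace MoritaContext

attribute [local instance] homLeftModule

variable (K : Type v) {A B M : Type u} [Field K] [Ring A] [Algebra K A] [Ring B] [Algebra K B]
  [AddCommGroup M] [Module B M] [Module Aᵐᵒᵖ M] [IsBimodule K B A M]
  [Module.Finite B M] [Module.Projective B M]

/-- The Morita context of a `(B, A)`-bimodule `M` which is a progenerator over `B` and for which
right multiplication identifies `A` with `End_B(M)`. -/
def ofProgenerator (hA : Function.Bijective (rightMulHom A B M)) (hM : IsGenerator B M) :
    MoritaContext K A B where
  M := M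
  N := M →ₗ[B] B
  bimoduleN := .dual K
  ε := dualTensorRingIso hA
  η := (evaluationIso hA.surjective hM).symm
  triangle_M m f m' := op_dualTensorRingIso_smul hA (BalTensor.tmul B f m') m
  triangle_N f m f' := LinearMap.ext fun x => by
    refine (congrArg f' (op_dualTensorRingIso_smul hA (BalTensor.tmul B f m) x)).trans ?_
    rw [dualTensorHomA_tmul, map_smul, LinearMap.smul_apply, op_smul_eq_mul, smul_eq_mul]
    rfl

theorem ofProgenerator_compatible (hA : Function.Bijective (rightMulHom A B M))
    (hM : IsGenerator B M) {lamA : SymmFrobeniusForm K A} {lamB : SymmFrobeniusForm K B}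
    (htr : ∀ a : A, lamA.form a = frobeniusTrace M lamB (rightMulHom A B M a)) :
    (ofProgenerator K hA hM).Compatible lamA lamB := by
  intro r (f : Fin r → (M →ₗ[B] B)) (m : Fin r → M) h a
  have dual_basis (x : M) : x = ∑ i, f i x • m i := by
    have iso_eq_one : (dualTensorRingIso hA).toLinearEquiv (∑ i, .tmul B (f i) (m i)) = 1 :=
      ((LinearEquiv.symm_apply_eq _).1 h).symm
    have := op_dualTensorRingIso_smul hA (∑ i, BalTensor.tmul B (f i) (m i)) x
    simpa only [iso_eq_one, op_one, one_smul, map_sum, LinearMap.sum_apply,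
      dualTensorHomA_tmul] using this
  exact (htr a).trans (frobeniusTrace_eq lamB dual_basis _)

end MoritaContext

section Functor

open FGModuleCat

variable {A B : Type u} [Ring A] [Ring B] (F : FGModuleCat.{u} A ⥤ FGModuleCat.{u} B) [F.Additive]

/-- The map `Hom_A(X, Y) → Hom_B(F(X), F(Y))` given by an additive functor `F`. -/
def mapLinear (X Y : FGModuleCat.{u} A) : (X →ₗ[A] Y) →+ (F.obj X →ₗ[B] F.obj Y) :=
  AddMonoidHom.mk' (fun f => (F.map (ofHom f : X ⟶ Y)).hom.hom) fun f g =>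
    congrArg (fun h => h.hom.hom) (F.map_add (f := (ofHom f : X ⟶ Y)) (g := ofHom g))

theorem mapLinear_id (X : FGModuleCat.{u} A) : mapLinear F X X LinearMap.id = LinearMap.id :=
  congrArg (fun h => h.hom.hom) (F.map_id X)

variable {F} in
theorem mapLinear_comp {X Y Z : FGModuleCat.{u} A} (g : Y →ₗ[A] Z) (f : X →ₗ[A] Y) :
    mapLinear F X Z (g ∘ₗ f) = mapLinear F Y Z g ∘ₗ mapLinear F X Y f :=
  congrArg (fun h => h.hom.hom) (F.map_comp (ofHom f : X ⟶ Y) (ofHom g : Y ⟶ Z))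

theorem mapLinear_bijective [F.Full] [F.Faithful] (X Y : FGModuleCat.{u} A) :
    Function.Bijective (mapLinear F X Y) := by
  refine ⟨fun f g h => ?_, fun g => ?_⟩
  · have : F.map (ofHom f) = F.map (ofHom g) := hom_ext h
    exact congrArg (fun h => h.hom.hom) (F.map_injective this)
  · obtain ⟨f, hf⟩ := F.map_surjective (ofHom g : F.obj X ⟶ F.obj Y)
    exact ⟨f.hom.hom, congrArg (fun h => h.hom.hom) hf⟩

end Functor

/-- The image `F(A)` of the regular module under a functor `F`; when `F` is additive, right
multiplication on `A` makes it a `(B, A)`-bimodule. -/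
def RegularImage {A B : Type u} [Ring A] [Ring B] (F : FGModuleCat.{u} A ⥤ FGModuleCat.{u} B) :
    Type u :=
  F.obj (FGModuleCat.of A A)

namespace RegularImage

open FGModuleCat

variable {A B : Type u} [Ring A] [Ring B] (F : FGModuleCat.{u} A ⥤ FGModuleCat.{u} B)

instance : AddCommGroup (RegularImage F) := inferInstanceAs (AddCommGroup (F.obj (of A A)))

instance : Module B (RegularImage F) := inferInstanceAs (Module B (F.obj (of A A)))

instance : Module.Finite B (RegularImage F) := inferInstanceAs (Module.Finite B (F.obj (of A A)))

instance [IsSemisimpleRing B] : Module.Projective B (RegularImage F) :=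
  projective_fgModuleCat (F.obj (of A A))

variable [F.Additive]

/-- For `x : X`, the image `F(A) → F(X)` of the `A`-linear map `A → X`, `a ↦ a.x`. -/
def act (X : FGModuleCat.{u} A) : X →+ (RegularImage F →ₗ[B] F.obj X) :=
  (mapLinear F (of A A) X).comp (LinearMap.ringLmapEquivSelf A ℕ X).symm.toAddMonoidHom

variable {F} in
theorem mapLinear_act {X Y : FGModuleCat.{u} A} (f : X →ₗ[A] Y) (x : X) :
    mapLinear F X Y f ∘ₗ act F X x = act F Y (f x) := by
  refine (mapLinear_comp (X := of A A) f _).symm.trans (congrArg (mapLinear F (of A A) Y) ?_)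
  exact LinearMap.ext fun a => map_smul f a x

theorem act_one : act F (of A A) (1 : A) = LinearMap.id :=
  (congrArg (mapLinear F (of A A) (of A A)) (LinearMap.ext fun a => mul_one a)).trans
    (mapLinear_id F (of A A))

instance : Module Aᵐᵒᵖ (RegularImage F) where
  smul a m := act F (of A A) a.unop m
  one_smul := LinearMap.congr_fun (act_one F)
  mul_smul a b m := (LinearMap.congr_fun (mapLinear_act (X := of A A) (Y := of A A)
    (LinearMap.toSpanSingleton A A a.unop) b.unop) m).symm
  smul_zero _ := map_zero _
  smul_add _ := map_add _
  add_smul a b := LinearMap.congr_fun (map_add (act F (of A A)) a.unop b.unop)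
  zero_smul := LinearMap.congr_fun (map_zero (act F (of A A)))

instance : SMulCommClass B Aᵐᵒᵖ (RegularImage F) where
  smul_comm b a m := (map_smul (act F (of A A) a.unop) b m).symm

variable {F} in
theorem act_smul {X : FGModuleCat.{u} A} (a : A) (x : X) (m : RegularImage F) :
    act F X x (op a • m) = act F X (a • x) m :=
  LinearMap.congr_fun (mapLinear_act (X := of A A) (LinearMap.toSpanSingleton A X x) a) m

instance {K : Type*} [Field K] [Algebra K A] [Algebra K B] [F.Linear K] :
    IsBimodule K B A (RegularImage F) where
  central k m := by
    have ofHom_scalar :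
        ofHom (LinearMap.toSpanSingleton A A (algebraMap K A k)) = k • 𝟙 (of A A) :=
      hom_ext (LinearMap.ext fun a => (Algebra.commutes k a).symm)
    have map_scalar : F.map (ofHom (LinearMap.toSpanSingleton A A (algebraMap K A k))) =
        k • 𝟙 (F.obj (of A A)) := by
      rw [ofHom_scalar, F.map_smul, F.map_id]
    exact congrArg (fun g => g.hom.hom m) map_scalar.symm

theorem rightMulHom_bijective [F.Full] [F.Faithful] :
    Function.Bijective (rightMulHom A B (RegularImage F)) :=
  (mapLinear_bijective F (of A A) (of A A)).comp (LinearMap.ringLmapEquivSelf A ℕ A).symm.bijective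

/-- The image `F(X) → F(A)` of a linear form on `X`. -/
def mapDual (X : FGModuleCat.{u} A) : (X →ₗ[A] A) →+ (F.obj X →ₗ[B] RegularImage F) :=
  mapLinear F X (of A A)

variable {F} in
theorem mapDual_act {X : FGModuleCat.{u} A} (f : X →ₗ[A] A) (x : X) (m : RegularImage F) :
    mapDual F X f (act F X x m) = op (f x) • m :=
  LinearMap.congr_fun (mapLinear_act (Y := of A A) f x) m

variable {F} in
theorem sum_act_mapDual {X : FGModuleCat.{u} A} {r : ℕ} {f : Fin r → (X →ₗ[A] A)}
    {p : Fin r → X} (h : ∀ x, x = ∑ i, f i x • p i) (y : F.obj X) :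
    ∑ i, act F X (p i) (mapDual F X (f i) y) = y := by
  have id_eq : LinearMap.id = ∑ i, LinearMap.toSpanSingleton A X (p i) ∘ₗ f i :=
    LinearMap.ext fun x => by
      rw [LinearMap.sum_apply]
      exact h x
  have map_id_eq : LinearMap.id = ∑ i, act F X (p i) ∘ₗ mapDual F X (f i) :=
    calc LinearMap.id = mapLinear F X X LinearMap.id := (mapLinear_id F X).symm
      _ = ∑ i, mapLinear F X X (LinearMap.toSpanSingleton A X (p i) ∘ₗ f i) := by
        rw [id_eq, map_sum]
      _ = ∑ i, act F X (p i) ∘ₗ mapDual F X (f i) :=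
        Finset.sum_congr rfl fun i _ => mapLinear_comp (Y := of A A) _ (f i)
  have := LinearMap.congr_fun map_id_eq y
  rw [LinearMap.sum_apply] at this
  exact this.symm

theorem isGenerator [IsSemisimpleRing A] [F.EssSurj] : IsGenerator B (RegularImage F) := by
  let X := F.objPreimage (of B B)
  let e : F.obj X ≃ₗ[B] B := isoToLinearEquiv (F.objObjPreimageIso (of B B))
  have : Module.Projective A X := projective_fgModuleCat X
  obtain ⟨r, f, p, h⟩ := exists_dualBasis A X
  refine ⟨r, fun i => e.toLinearMap ∘ₗ act F X (p i),
    fun i => mapDual F X (f i) (e.symm 1), ?_⟩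
  have := congrArg e (sum_act_mapDual h (e.symm 1))
  rwa [map_sum, e.apply_symm_apply] at this

/-- The canonical map `F(A) ⊗_A X → F(X)` of the Eilenberg–Watts theorem. -/
def tensorHom (X : FGModuleCat.{u} A) : BalTensor A (RegularImage F) X →ₗ[B] F.obj X where
  __ := BalTensor.lift (AddMonoidHom.mk' (fun m => AddMonoidHom.mk' (fun x : X => act F X x m)
    fun x y => LinearMap.congr_fun (map_add (act F X) x y) m)
    fun m n => by ext x; exact map_add (act F X x) m n) fun m a x => act_smul a x m
  map_smul' := BalTensor.map_left_smul_of_tmul fun b m x => map_smul (act F X x) b m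

@[simp]
theorem tensorHom_tmul (X : FGModuleCat.{u} A) (m : RegularImage F) (x : X) :
    tensorHom F X (BalTensor.tmul A m x) = act F X x m := rfl

theorem tensorHom_lTensor {X Y : FGModuleCat.{u} A} (f : X →ₗ[A] Y)
    (z : BalTensor A (RegularImage F) X) :
    tensorHom F Y (BalTensor.lTensor B (RegularImage F) f z) =
      mapLinear F X Y f (tensorHom F X z) := by
  induction z using BalTensor.induction_on with
  | zero => simp only [map_zero]
  | tmul m x => exact (LinearMap.congr_fun (mapLinear_act f x) m).symm
  | add y z hy hz => simp only [map_add, hy, hz]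

variable {F} in
theorem sum_mapDual_tensorHom_tmul {X : FGModuleCat.{u} A} {r : ℕ} {f : Fin r → (X →ₗ[A] A)}
    {p : Fin r → X} (h : ∀ x, x = ∑ i, f i x • p i) (z : BalTensor A (RegularImage F) X) :
    ∑ i, BalTensor.tmul A (mapDual F X (f i) (tensorHom F X z)) (p i) = z := by
  induction z using BalTensor.induction_on with
  | zero => simp only [map_zero, BalTensor.zero_tmul, Finset.sum_const_zero]
  | tmul m x =>
    simp only [tensorHom_tmul, mapDual_act, BalTensor.smul_tmul, ← BalTensor.tmul_sum, ← h x]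
  | add y z hy hz => simp only [map_add, BalTensor.add_tmul, Finset.sum_add_distrib, hy, hz]

theorem tensorHom_bijective (X : FGModuleCat.{u} A) [Module.Projective A X] :
    Function.Bijective (tensorHom F X) := by
  obtain ⟨r, f, p, h⟩ := exists_dualBasis A X
  refine ⟨fun y z hyz => ?_, fun y => ?_⟩
  · rw [← sum_mapDual_tensorHom_tmul h y, ← sum_mapDual_tensorHom_tmul h z, hyz]
  · refine ⟨∑ i, BalTensor.tmul A (mapDual F X (f i) y) (p i), ?_⟩
    simpa only [map_sum, tensorHom_tmul] using sum_act_mapDual h y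

section Semisimple

attribute [local instance] projective_fgModuleCat

variable (K : Type v) [Field K] [Algebra K A] [IsSemisimpleRing A] [Algebra K B]
  [IsSemisimpleRing B] [F.IsEquivalence] [F.Linear K]

/-- The Morita context of an equivalence `F`, with bimodules `F(A)` and `Hom_B(F(A), B)`. -/
def moritaContext : MoritaContext K A B :=
  .ofProgenerator K (rightMulHom_bijective F) (isGenerator F)

/-- The functor `F(A) ⊗_A -` given by the Morita context of `F` is naturally isomorphic to `F`. -/
def repFGIso : (moritaContext F K).repFG ≅ F :=
  have (X : FGModuleCat.{u} A) : Module.Finite B (BalTensor A (RegularImage F) X) :=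
    MoritaContext.finite_balTensor A B (RegularImage F) X
  NatIso.ofComponents
    (fun X => (LinearEquiv.ofBijective (tensorHom F X)
      (tensorHom_bijective F X)).toFGModuleCatIso)
    fun f => hom_ext (LinearMap.ext (tensorHom_lTensor F f.hom.hom))

variable {F K} in
theorem moritaContext_compatible {lamA : SymmFrobeniusForm K A} {lamB : SymmFrobeniusForm K B}
    (hF : IsCalabiYauFunctor lamA.calabiYau lamB.calabiYau F) :
    (moritaContext F K).Compatible lamA lamB :=
  MoritaContext.ofProgenerator_compatible K _ _ fun a => by
    have trace_eq : frobeniusTrace A lamA (LinearMap.toSpanSingleton A A a) = lamA.form a :=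
      frobeniusTrace_smulRight lamA LinearMap.id a
    exact trace_eq.symm.trans (hF (of A A) (ofHom (LinearMap.toSpanSingleton A A a)))

end Semisimple

end RegularImage

end

theorem proposition4p2_general {K : Type v} [Field K]
    {A B : Type u} [Ring A] [Algebra K A] [IsSemisimpleRing A]
    [Ring B] [Algebra K B] [IsSemisimpleRing B]
    (lamA : SymmFrobeniusForm K A) (lamB : SymmFrobeniusForm K B)
    (F : FGModuleCat.{u} A ⥤ FGModuleCat.{u} B) [F.IsEquivalence] [F.Additive] [F.Linear K]
    (hF : IsCalabiYauFunctor lamA.calabiYau lamB.calabiYau F) :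
    ∃ C : MoritaContext K A B, C.Compatible lamA lamB ∧ Nonempty (C.repFG ≅ F) :=
  ⟨RegularImage.moritaContext F K, RegularImage.moritaContext_compatible hF,
    ⟨RegularImage.repFGIso F K⟩⟩

theorem proposition4p2 {K : Type v} [Field K] [IsAlgClosed K]
    {A B : Type u} [Ring A] [Algebra K A] [IsSemisimpleRing A]
    [Ring B] [Algebra K B] [IsSemisimpleRing B]
    (lamA : SymmFrobeniusForm K A) (lamB : SymmFrobeniusForm K B)
    (F : FGModuleCat.{u} A ⥤ FGModuleCat.{u} B) [F.IsEquivalence] [F.Additive] [F.Linear K]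
    (hF : IsCalabiYauFunctor lamA.calabiYau lamB.calabiYau F) :
    ∃ C : MoritaContext K A B, C.Compatible lamA lamB ∧ Nonempty (C.repFG ≅ F) :=
  proposition4p2_general lamA lamB F hF
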